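/- For a finite graph $H$ on $h$ vertices, $\gamma \in [0,1]$ and $\varepsilon > 0$, let $\delta(\varepsilon,H;\gamma)$ denote the maximum $\delta \in [0,1]$ such that, for every $n$, every $n$-vertex graph with fewer than $\delta n^h$ copies of $H$ (subgraphs isomorphic to $H$) and with minimum degree at least $\gamma n$ can be made $H$-free (i.e. to contain no subgraph isomorphic to $H$) by deleting at most $\varepsilon n^2$ edges. The linear removal threshold of $H$ is $$\delta_{\text{lin-rem}}(H) = \inf\{\gamma \in [0,1] : \text{there exists } \mu>0 \text{ such that } \delta(\varepsilon,H;\gamma) \ge \mu\varepsilon \text{ for all } \varepsilon\in(0,1)\}.$$ Let $K_r[s]$ denote the complete $r$-partite graph with $s$ vertices in each part. Then for all integers $r \ge 3$ and $s \ge 2$, $$\delta_{\text{lin-rem}}(K_r[s]) = \frac{r-2}{r-1}.$$ -/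

import Mathlib

namespace MinDegreeRemoval

/-- `G` can be made `H`-free by deleting at most `m` edges. -/
def CanMakeFree {V W : Type*} (H : SimpleGraph W) (G : SimpleGraph V) (m : ℝ) : Prop :=
  ∃ E : Finset (Sym2 V), (E : Set (Sym2 V)) ⊆ G.edgeSet ∧ (E.card : ℝ) ≤ m ∧
    H.Free (G.deleteEdges (E : Set (Sym2 V)))

open Classical in
/-- `δ` is admissible for `(ε, H, γ)`: every graph on `n` vertices (for every `n`) with fewer than
`δ * n ^ |V(H)|` copies of `H` and minimum degree at least `γ * n` can be made `H`-free by deleting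
at most `ε * n ^ 2` edges. Copies are unlabelled, i.e. subgraphs isomorphic to `H`. -/
def Admissible {W : Type*} [Fintype W] (H : SimpleGraph W) (γ ε δ : ℝ) : Prop :=
  ∀ (n : ℕ) (G : SimpleGraph (Fin n)),
    (G.copyCount H : ℝ) < δ * (n : ℝ) ^ Fintype.card W →
    γ * (n : ℝ) ≤ (G.minDegree : ℝ) →
    CanMakeFree H G (ε * (n : ℝ) ^ 2)

/-- The restricted removal function `δ(ε, H; γ)`: the largest admissible `δ ∈ [0, 1]`.
The supremum is attained, see `isGreatest_removalDelta`. -/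
noncomputable def removalDelta {W : Type*} [Fintype W] (H : SimpleGraph W) (γ ε : ℝ) : ℝ :=
  sSup {δ : ℝ | δ ∈ Set.Icc (0 : ℝ) 1 ∧ Admissible H γ ε δ}

theorem isGreatest_removalDelta {W : Type*} [Fintype W] (H : SimpleGraph W) (γ ε : ℝ) :
    IsGreatest {δ : ℝ | δ ∈ Set.Icc (0 : ℝ) 1 ∧ Admissible H γ ε δ} (removalDelta H γ ε) := by
  have hbdd : BddAbove {δ : ℝ | δ ∈ Set.Icc (0 : ℝ) 1 ∧ Admissible H γ ε δ} :=
    ⟨1, fun δ hδ => hδ.1.2⟩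
  have h0 : (0 : ℝ) ∈ {δ : ℝ | δ ∈ Set.Icc (0 : ℝ) 1 ∧ Admissible H γ ε δ} := by
    refine ⟨⟨le_rfl, zero_le_one⟩, fun n G hlt _ => ?_⟩
    rw [zero_mul] at hlt
    exact absurd hlt (not_lt.mpr (Nat.cast_nonneg _))
  refine ⟨⟨⟨le_csSup hbdd h0, csSup_le ⟨0, h0⟩ fun δ hδ => hδ.1.2⟩, ?_⟩,
    fun δ hδ => le_csSup hbdd hδ⟩
  intro n G hlt hdeg
  have hpos : (0 : ℝ) < (n : ℝ) ^ Fintype.card W := by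
    rcases (show (0 : ℝ) ≤ (n : ℝ) ^ Fintype.card W by positivity).lt_or_eq with h | h
    · exact h
    · rw [← h, mul_zero] at hlt
      exact absurd hlt (not_lt.mpr (Nat.cast_nonneg _))
  obtain ⟨δ, hδ, hlt'⟩ := exists_lt_of_lt_csSup ⟨0, h0⟩ ((div_lt_iff₀ hpos).mpr hlt)
  exact hδ.2 n G ((div_lt_iff₀ hpos).mp hlt') hdeg

/-- The linear removal threshold of `H`. -/
noncomputable def linearRemovalThreshold {W : Type*} [Fintype W] (H : SimpleGraph W) : ℝ :=
  sInf {γ : ℝ | γ ∈ Set.Icc (0 : ℝ) 1 ∧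
    ∃ μ : ℝ, 0 < μ ∧ ∀ ε : ℝ, ε ∈ Set.Ioo (0 : ℝ) 1 → μ * ε ≤ removalDelta H γ ε}

end MinDegreeRemoval

/-! The set of good `γ` is exactly the interval from `(r-2)/(r-1)`, excluded, to `1`. Above the
threshold, at most `r-1` vertices always have linearly many common neighbours, so cliques built
greedily give a positive density of `K_r`, and convexity turns this into a positive density of
`K_r[s]` (`exists_mul_pow_le_copyCount`). For large `n` the hypothesis of few copies is then never
met; bounded `n` is absorbed in `μ`. At or below the threshold, take the balanced complete
`(r-1)`-partite graph and plant `N` disjoint cliques of size `2s` in one part. It contains `N`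
edge-disjoint copies of `K_r[s]`, so order `n` deletions are needed. Since `s ≥ 2`, every copy has
three vertices in one planted clique, so there are only `O(n^(h-2))` copies, where `h = r s`. With
`ε` of order `1/n`, this contradicts a bound `μ ε n^h` of order `n^(h-1)`. -/

namespace MinDegreeRemoval

universe u

open Finset SimpleGraph

/-! ### Counting maps and copies -/

section Counting

/-- Counting functions whose values on `S` are determined by the values outside `S` together with
an element of `D`. -/
theorem card_filter_fun_le {W V D : Type*} [Fintype W] [DecidableEq W] [Fintype V] [Fintype D]
    (P : (W → V) → Prop) [DecidablePred P] (S : Finset W) (d : (W → V) → D)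
    (hd : ∀ y y', P y → P y' → (∀ w, w ∉ S → y w = y' w) → d y = d y' → y = y') :
    #{y : W → V | P y} ≤ Fintype.card D * Fintype.card V ^ (Fintype.card W - #S) := by
  have hcard : Fintype.card ({w // w ∉ S} → V) = Fintype.card V ^ (Fintype.card W - #S) := by
    rw [Fintype.card_fun]
    congr 1
    rw [Fintype.card_subtype_compl]
    simp
  rw [← hcard, mul_comm, ← Fintype.card_prod]
  refine Finset.card_le_card_of_injOn (t := univ)
    (fun y => ((fun w : {w // w ∉ S} => y w), d y)) (by simp) ?_
  intro y hy y' hy' h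
  simp only [coe_filter, mem_univ, true_and, Set.mem_ofPred_eq] at hy hy'
  simp only [Prod.mk.injEq] at h
  exact hd y y' hy hy' (fun w hw => congrFun h.1 ⟨w, hw⟩) h.2

theorem card_not_injective_le {W V : Type*} [Fintype W] [DecidableEq W] [Fintype V]
    [DecidablePred fun y : W → V => ¬ Function.Injective y] :
    #{y : W → V | ¬ Function.Injective y} ≤
      Fintype.card W ^ 2 * Fintype.card V ^ (Fintype.card W - 1) := by
  classical
  have hsub : ({y : W → V | ¬ Function.Injective y} : Finset (W → V)) ⊆
      (univ : Finset (W × W)).biUnion fun p => {y : W → V | p.1 ≠ p.2 ∧ y p.1 = y p.2} := by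
    intro y hy
    simp only [mem_filter, mem_univ, true_and, Function.Injective, not_forall] at hy
    obtain ⟨a, b, hab, hne⟩ := hy
    simp only [mem_biUnion, mem_univ, true_and, mem_filter, Prod.exists]
    exact ⟨a, b, hne, hab⟩
  refine (card_le_card hsub).trans ((card_biUnion_le_card_mul _ _
    (Fintype.card V ^ (Fintype.card W - 1)) ?_).trans ?_)
  · rintro ⟨a, b⟩ -
    refine (card_filter_fun_le _ {a} (fun _ => ()) ?_).trans (by simp)
    rintro y y' ⟨hab, h⟩ ⟨-, h'⟩ hw -
    funext w
    by_cases hwa : w = a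
    · subst hwa
      exact h.trans ((hw b (by simpa using hab.symm)).trans h'.symm)
    · exact hw w (by simpa using hwa)
  · simp [sq]

theorem labelledCopyCount_eq_card_filter {V W : Type*} [Fintype V] [Fintype W] [DecidableEq W]
    (G : SimpleGraph V) (H : SimpleGraph W)
    [DecidablePred fun y : W → V => Function.Injective y ∧ ∀ a b, H.Adj a b → G.Adj (y a) (y b)] :
    G.labelledCopyCount H =
      #{y : W → V | Function.Injective y ∧ ∀ a b, H.Adj a b → G.Adj (y a) (y b)} := by
  unfold labelledCopyCount
  rw [← Fintype.card_subtype, Fintype.card_eq_nat_card, Fintype.card_eq_nat_card]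
  exact Nat.card_congr
    { toFun := fun f => ⟨f, f.injective, fun _ _ h => f.toHom.map_adj h⟩
      invFun := fun y => ⟨⟨y.1, fun h => y.2.2 _ _ h⟩, y.2.1⟩
      left_inv := fun _ => rfl
      right_inv := fun _ => rfl }

/-- A labelled copy with a given image is a map into the `|W|` vertices of that image. -/
theorem labelledCopyCount_le_mul_copyCount {V W : Type*} [Fintype V] [Fintype W]
    (G : SimpleGraph V) (H : SimpleGraph W) :
    G.labelledCopyCount H ≤ Fintype.card W ^ Fintype.card W * G.copyCount H := by
  classical
  rw [copyCount_eq_card_image_copyToSubgraph, labelledCopyCount, ← card_univ]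
  refine card_le_mul_card_image _ _ ?_
  intro G' hG'
  obtain ⟨g, -, hg⟩ := mem_image.1 hG'
  have e : W ≃ G'.verts := hg ▸ g.isoToSubgraph.toEquiv
  have hcard : Fintype.card W ^ Fintype.card W = Fintype.card (W → G'.verts) := by
    rw [Fintype.card_fun, Fintype.card_congr e]
  rw [hcard, ← card_univ]
  have hmem : ∀ f : H.Copy G, f.toSubgraph = G' → ∀ w, f w ∈ G'.verts := by
    rintro f rfl w
    simp
  -- The default `e w` is never taken on the fibre over `G'`.
  refine card_le_card_of_injOn
    (fun f w => if h : f w ∈ G'.verts then ⟨f w, h⟩ else e w) (by simp) ?_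
  intro f hf f' hf' h
  simp only [coe_filter, mem_univ, true_and, Set.mem_ofPred_eq] at hf hf'
  ext w
  have := congrFun h w
  simpa [hmem f hf w, hmem f' hf' w] using this

end Counting

/-! ### Blow-ups by convexity -/

section BlowUp

/-- The weight of the `s`-fold blow-up of a weighted `k`-partite hypergraph of density `α`, where
`s = m + 1`, is at least `α ^ (s ^ k)`. The parameter `t` carries the coordinates which
are already blown up. -/
theorem le_sum_prod_blowUp {V : Type u} [Fintype V] [Nonempty V] (m k : ℕ) :
    ∀ {T : Type u} [Fintype T] [Nonempty T] (f : T → (Fin k → V) → ℝ),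
      (∀ t v, 0 ≤ f t v) → ∀ α : ℝ, 0 ≤ α →
      α * (Fintype.card T * (Fintype.card V : ℝ) ^ k) ≤ ∑ t, ∑ v, f t v →
      α ^ ((m + 1) ^ k) * (Fintype.card T * ((Fintype.card V : ℝ) ^ (m + 1)) ^ k) ≤
        ∑ t, ∑ x : Fin k → Fin (m + 1) → V, ∏ c : Fin k → Fin (m + 1), f t fun i => x i (c i) := by
  induction k with
  | zero =>
    intro T _ _ f _ α _ h
    simpa [Subsingleton.elim _ (default : Fin 0 → V)] using h
  | succ k ih =>
    intro T _ _ f hf α hα h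
    have hV : (0 : ℝ) < Fintype.card V := by exact_mod_cast Fintype.card_pos
    have hT : (0 : ℝ) < Fintype.card T := by exact_mod_cast Fintype.card_pos
    -- Blow up the first coordinate and move it into the parameter; the power mean inequality below
    -- shows that the density is then at least `α ^ (m + 1)`.
    have key := ih (T := T × (Fin (m + 1) → V))
      (fun t v => ∏ j, f t.1 (Fin.cons (t.2 j) v))
      (fun t v => prod_nonneg fun j _ => hf _ _) (α ^ (m + 1)) (by positivity) ?_
    · refine le_of_eq_of_le ?_ (key.trans_eq ?_)
      · simp only [Fintype.card_prod, Fintype.card_fun, Fintype.card_fin, Nat.cast_mul,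
          Nat.cast_pow]
        ring
      · rw [Fintype.sum_prod_type]
        refine sum_congr rfl fun t _ => ?_
        rw [← (Fin.consEquiv fun _ => (Fin (m + 1) → V)).sum_comp, Fintype.sum_prod_type]
        refine sum_congr rfl fun y _ => sum_congr rfl fun x _ => ?_
        rw [← (Fin.consEquiv fun _ => Fin (m + 1)).prod_comp, Fintype.prod_prod_type, prod_comm]
        refine prod_congr rfl fun j _ => prod_congr rfl fun c _ => ?_
        congr 1
        funext i
        refine Fin.cases ?_ (fun i => ?_) i <;> simp [Fin.consEquiv]
    · have h1 : ∑ t : T × (Fin (m + 1) → V), ∑ v : Fin k → V,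
          ∏ j, f t.1 (Fin.cons (t.2 j) v) =
          ∑ p : T × (Fin k → V), (∑ u, f p.1 (Fin.cons u p.2)) ^ (m + 1) := by
        rw [Fintype.sum_prod_type, Fintype.sum_prod_type]
        refine sum_congr rfl fun t _ => ?_
        rw [sum_comm]
        refine sum_congr rfl fun v _ => ?_
        have := (Finset.prod_univ_sum (fun _ : Fin (m + 1) => (univ : Finset V))
          (fun _ u => f t (Fin.cons u v))).symm
        simpa using this
      have h2 : ∑ t, ∑ v, f t v = ∑ p : T × (Fin k → V), ∑ u, f p.1 (Fin.cons u p.2) := by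
        rw [Fintype.sum_prod_type]
        refine sum_congr rfl fun t _ => ?_
        rw [← (Fin.consEquiv fun _ => V).sum_comp, Fintype.sum_prod_type, sum_comm]
        rfl
      have h3 := pow_sum_le_card_mul_sum_pow (s := (univ : Finset (T × (Fin k → V))))
        (f := fun p => ∑ u, f p.1 (Fin.cons u p.2)) (fun p _ => sum_nonneg fun u _ => hf _ _) m
      rw [h2] at h
      have h4 := (pow_le_pow_left₀ (by positivity) h (m + 1)).trans h3
      rw [h1]
      simp only [card_univ, Fintype.card_prod, Fintype.card_fun, Fintype.card_fin, Nat.cast_mul,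
        Nat.cast_pow] at h4 ⊢
      refine le_of_mul_le_mul_left (le_of_eq_of_le ?_ h4)
        (show (0 : ℝ) < (Fintype.card T * (Fintype.card V : ℝ) ^ k) ^ m by positivity)
      ring

end BlowUp

/-! ### Greedy clique counting -/

section Cliques

variable {V : Type*} (G : SimpleGraph V)

open Classical in
/-- Indicator of the ordered cliques of size `k`. -/
noncomputable def cliqueInd {k : ℕ} (v : Fin k → V) : ℝ :=
  if ∀ i j, i ≠ j → G.Adj (v i) (v j) then 1 else 0

theorem cliqueInd_nonneg {k : ℕ} (v : Fin k → V) : 0 ≤ cliqueInd G v := by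
  unfold cliqueInd
  split_ifs <;> norm_num

open Classical in
theorem cliqueInd_cons {k : ℕ} (u : V) (v : Fin k → V) :
    cliqueInd G (Fin.cons u v : Fin (k + 1) → V) =
      cliqueInd G v * if ∀ i, G.Adj u (v i) then 1 else 0 := by
  have : (∀ i j, i ≠ j → G.Adj ((Fin.cons u v : Fin (k + 1) → V) i)
      ((Fin.cons u v : Fin (k + 1) → V) j)) ↔
      (∀ i j, i ≠ j → G.Adj (v i) (v j)) ∧ ∀ i, G.Adj u (v i) := by
    simp only [Fin.forall_fin_succ, Fin.cons_zero, Fin.cons_succ, ne_eq, not_true_eq_false,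
      IsEmpty.forall_iff, true_and, Fin.succ_inj, Fin.succ_ne_zero, not_false_eq_true,
      forall_const, (Fin.succ_ne_zero _).symm]
    constructor
    · rintro ⟨h1, h2⟩
      exact ⟨fun i => (h2 i).2, h1⟩
    · rintro ⟨h1, h2⟩
      exact ⟨h2, fun i => ⟨(h2 i).symm, h1 i⟩⟩
  unfold cliqueInd
  simp only [this, ite_and, mul_ite, mul_one, mul_zero]
  split_ifs <;> rfl

open Classical in
theorem card_common_neighbors_ge [Fintype V] {k : ℕ} (d : ℝ)
    (hd : ∀ v, d ≤ G.degree v) (v : Fin k → V) :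
    Fintype.card V - k * (Fintype.card V - d) ≤ (#{u | ∀ i, G.Adj u (v i)} : ℝ) := by
  have hcompl : #({u | ∀ i, G.Adj u (v i)} : Finset V)ᶜ ≤
      ∑ i, #(G.neighborFinset (v i))ᶜ := by
    refine (card_le_card ?_).trans card_biUnion_le
    intro u hu
    simp only [mem_compl, mem_filter, mem_univ, true_and, not_forall] at hu
    obtain ⟨i, hi⟩ := hu
    simp only [mem_biUnion, mem_univ, true_and, mem_compl, mem_neighborFinset]
    exact ⟨i, fun h => hi h.symm⟩
  have hsum : (∑ i, (#(G.neighborFinset (v i))ᶜ : ℝ)) ≤ k * (Fintype.card V - d) := by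
    refine (sum_le_card_nsmul univ _ (Fintype.card V - d) fun i _ => ?_).trans (by simp)
    have h := card_add_card_compl (G.neighborFinset (v i))
    rw [card_neighborFinset_eq_degree] at h
    have h' : (G.degree (v i) : ℝ) + #(G.neighborFinset (v i))ᶜ = Fintype.card V := by
      exact_mod_cast h
    linarith [hd (v i)]
  have h := card_add_card_compl ({u | ∀ i, G.Adj u (v i)} : Finset V)
  have h' : (#({u | ∀ i, G.Adj u (v i)} : Finset V) : ℝ) +
      #({u | ∀ i, G.Adj u (v i)} : Finset V)ᶜ = Fintype.card V := by exact_mod_cast h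
  have hcompl' : (#({u | ∀ i, G.Adj u (v i)} : Finset V)ᶜ : ℝ) ≤
      ∑ i, (#(G.neighborFinset (v i))ᶜ : ℝ) := by exact_mod_cast hcompl
  linarith

open Classical in
theorem pow_le_sum_cliqueInd [Fintype V] {r : ℕ} {γ : ℝ} (hγ : γ ≤ 1)
    (hc : 0 ≤ 1 - ((r : ℝ) - 1) * (1 - γ)) (hd : ∀ v, γ * Fintype.card V ≤ G.degree v) :
    ∀ k ≤ r, ((1 - ((r : ℝ) - 1) * (1 - γ)) * Fintype.card V) ^ k ≤
      ∑ v : Fin k → V, cliqueInd G v := by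
  intro k
  induction k with
  | zero => simp [cliqueInd]
  | succ k ih =>
    intro hk
    rw [← (Fin.consEquiv fun _ => V).sum_comp, Fintype.sum_prod_type, sum_comm]
    calc ((1 - ((r : ℝ) - 1) * (1 - γ)) * Fintype.card V) ^ (k + 1)
        ≤ (∑ v : Fin k → V, cliqueInd G v) * ((1 - ((r : ℝ) - 1) * (1 - γ)) * Fintype.card V) := by
          rw [pow_succ]
          gcongr
          exact ih (by omega)
      _ ≤ ∑ v : Fin k → V, cliqueInd G v * (#{u | ∀ i, G.Adj u (v i)} : ℝ) := by
          rw [sum_mul]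
          refine sum_le_sum fun v _ => mul_le_mul_of_nonneg_left ?_ (cliqueInd_nonneg G v)
          refine le_trans ?_ (card_common_neighbors_ge G _ hd v)
          -- Only `k ≤ r - 1` vertices have been chosen, so at most `r - 1` non-neighbourhoods are
          -- lost.
          have hk' : (k : ℝ) + 1 ≤ r := by exact_mod_cast hk
          have hn : (0 : ℝ) ≤ Fintype.card V := by positivity
          nlinarith [mul_nonneg (mul_nonneg (sub_nonneg.2 hk') (sub_nonneg.2 hγ)) hn]
      _ = _ := by
          refine sum_congr rfl fun v _ => ?_
          rw [← sum_boole, mul_sum]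
          exact sum_congr rfl fun u _ => (cliqueInd_cons G u v).symm

end Cliques

/-! ### Positive density of `K_r[s]` -/

section Supersaturation

/-- The product is nonzero only on homomorphisms from `K_r[m+1]`; the error term bounds the
non-injective ones. -/
theorem sum_prod_cliqueInd_le {V : Type*} [Fintype V] (G : SimpleGraph V) (r m : ℕ) :
    ∑ x : Fin r → Fin (m + 1) → V, ∏ c : Fin r → Fin (m + 1), cliqueInd G (fun i => x i (c i)) ≤
      G.labelledCopyCount (completeEquipartiteGraph r (m + 1)) +
        ((r * (m + 1) : ℕ) : ℝ) ^ 2 * (Fintype.card V : ℝ) ^ (r * (m + 1) - 1) := by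
  classical
  have hle : ∀ x : Fin r → Fin (m + 1) → V,
      ∏ c : Fin r → Fin (m + 1), cliqueInd G (fun i => x i (c i)) ≤
        if ∀ i i' j j', i ≠ i' → G.Adj (x i j) (x i' j') then 1 else 0 := by
    intro x
    split_ifs with h
    · refine prod_le_one (fun c _ => cliqueInd_nonneg G _) fun c _ => ?_
      unfold cliqueInd
      split_ifs <;> norm_num
    · push Not at h
      obtain ⟨i, i', j, j', hi, hadj⟩ := h
      refine (prod_eq_zero (mem_univ fun a => if a = i then j else j') ?_).le
      refine if_neg fun hcl => hadj ?_
      simpa [hi.symm] using hcl i i' hi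
  refine (sum_le_sum fun x _ => hle x).trans ?_
  rw [sum_boole]
  let e : (Fin r → Fin (m + 1) → V) ≃ (Fin r × Fin (m + 1) → V) := (Equiv.curry _ _ _).symm
  have hcard : #{x : Fin r → Fin (m + 1) → V | ∀ i i' j j', i ≠ i' → G.Adj (x i j) (x i' j')} ≤
      G.labelledCopyCount (completeEquipartiteGraph r (m + 1)) +
        #{y : Fin r × Fin (m + 1) → V | ¬ Function.Injective y} := by
    rw [labelledCopyCount_eq_card_filter]
    refine le_trans ?_ (card_union_le _ _)
    refine card_le_card_of_injOn e ?_ e.injective.injOn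
    intro x hx
    simp only [coe_filter, mem_univ, true_and, Set.mem_ofPred_eq] at hx
    simp only [coe_union, coe_filter, mem_univ, true_and, Set.mem_union, Set.mem_ofPred_eq]
    by_cases hinj : Function.Injective (e x)
    · exact Or.inl ⟨hinj, fun a b hab => hx a.1 b.1 a.2 b.2 hab⟩
    · exact Or.inr hinj
  have hni := card_not_injective_le (W := Fin r × Fin (m + 1)) (V := V)
  simp only [Fintype.card_prod, Fintype.card_fin] at hni
  exact_mod_cast hcard.trans (Nat.add_le_add_left hni _)

open Classical in
/-- Supersaturation: a graph of minimum degree at least `γ n`, where `γ > (r - 2) / (r - 1)`,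
contains a positive proportion of all possible copies of `K_r[s]`. -/
theorem exists_mul_pow_le_copyCount (r s : ℕ) (hr : 2 ≤ r) (hs : 1 ≤ s) {γ : ℝ} (hγ : γ ≤ 1)
    (hγ' : ((r : ℝ) - 2) / ((r : ℝ) - 1) < γ) :
    ∃ β : ℝ, 0 < β ∧ ∃ n₀ : ℕ, ∀ n, n₀ ≤ n → ∀ G : SimpleGraph (Fin n),
      γ * (n : ℝ) ≤ G.minDegree →
      β * (n : ℝ) ^ (r * s) ≤ G.copyCount (completeEquipartiteGraph r s) := by
  obtain ⟨m, rfl⟩ : ∃ m, s = m + 1 := ⟨s - 1, by omega⟩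
  have hr' : (2 : ℝ) ≤ r := by exact_mod_cast hr
  have hc : 0 < 1 - ((r : ℝ) - 1) * (1 - γ) := by
    rw [div_lt_iff₀ (by linarith)] at hγ'
    linarith
  set c := 1 - ((r : ℝ) - 1) * (1 - γ) with hcdef
  set h := r * (m + 1) with hh
  have hpos : 0 < h := by positivity
  have hhR : (0 : ℝ) < h := by exact_mod_cast hpos
  set α := (c ^ r) ^ ((m + 1) ^ r) with hα
  have hαpos : 0 < α := by positivity
  -- For such `n` the non-injective maps use up at most half of `α n^h`; `h^h` pays for the
  -- labellings.
  refine ⟨α / 2 / (h : ℝ) ^ h, by positivity, ⌈2 * (h : ℝ) ^ 2 / α⌉₊ + 1, fun n hn G hdeg => ?_⟩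
  have hn1 : 2 * (h : ℝ) ^ 2 / α ≤ n :=
    (Nat.le_ceil _).trans (by exact_mod_cast (Nat.le_succ _).trans hn)
  have : Nonempty (Fin n) := ⟨⟨0, by omega⟩⟩
  have hcl := pow_le_sum_cliqueInd G hγ hc.le (r := r)
    (fun v => by
      rw [Fintype.card_fin]
      exact hdeg.trans (by exact_mod_cast G.minDegree_le_degree v)) r le_rfl
  have hbl := le_sum_prod_blowUp (V := Fin n) m r (T := Unit) (fun _ v => cliqueInd G v)
    (fun _ v => cliqueInd_nonneg G v) (c ^ r) (by positivity)
    (by simpa [mul_pow] using hcl)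
  have hup := sum_prod_cliqueInd_le G r m
  have hlab : (G.labelledCopyCount (completeEquipartiteGraph r (m + 1)) : ℝ) ≤
      (h : ℝ) ^ h * G.copyCount (completeEquipartiteGraph r (m + 1)) := by
    have := labelledCopyCount_le_mul_copyCount G (completeEquipartiteGraph r (m + 1))
    simp only [Fintype.card_prod, Fintype.card_fin] at this
    exact_mod_cast this
  simp only [univ_unique, sum_singleton, Fintype.card_unique, Nat.cast_one, one_mul,
    Fintype.card_fin, ← pow_mul] at hbl hup
  rw [mul_comm (m + 1) r] at hbl
  rw [pow_mul, ← hα] at hbl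
  have hsmall : (h : ℝ) ^ 2 * (n : ℝ) ^ (h - 1) ≤ α / 2 * (n : ℝ) ^ h := by
    have : (n : ℝ) ^ h = n ^ (h - 1) * n := by rw [← pow_succ]; congr 1; omega
    rw [this]
    rw [div_le_iff₀ hαpos] at hn1
    have hp : (0 : ℝ) ≤ (n : ℝ) ^ (h - 1) := by positivity
    nlinarith
  rw [div_mul_eq_mul_div, div_le_iff₀ (by positivity), mul_comm (Nat.cast _ : ℝ)]
  linarith

end Supersaturation

/-! ### The construction at the threshold -/

section LowerBound

open Classical in
/-- Admissibility for graphs on an arbitrary finite vertex type, stated with labelled copies. -/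
theorem Admissible.exists_free_deleteEdges {V W : Type*} [Fintype V] [Nonempty V] [Fintype W]
    {H : SimpleGraph W} {γ ε δ : ℝ} (hadm : Admissible H γ ε δ) (G : SimpleGraph V)
    (hlt : (G.labelledCopyCount H : ℝ) < δ * (Fintype.card V : ℝ) ^ Fintype.card W)
    (hdeg : ∀ v, γ * Fintype.card V ≤ G.degree v) :
    ∃ E : Finset (Sym2 V), (#E : ℝ) ≤ ε * (Fintype.card V : ℝ) ^ 2 ∧
      H.Free (G.deleteEdges (E : Set (Sym2 V))) := by
  let e := Fintype.equivFin V
  let G' : SimpleGraph (Fin (Fintype.card V)) := G.comap e.symm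
  let φ : G' ≃g G := ⟨e.symm, Iff.rfl⟩
  have : Nonempty (Fin (Fintype.card V)) := ⟨e (Classical.arbitrary V)⟩
  have hcount : G'.labelledCopyCount H ≤ G.labelledCopyCount H := by
    unfold labelledCopyCount
    rw [Fintype.card_eq_nat_card (α := H.Copy G'), Fintype.card_eq_nat_card (α := H.Copy G)]
    refine Nat.card_le_card_of_injective (fun f => φ.toCopy.comp f) fun f g hfg => ?_
    ext w : 1
    exact φ.injective (DFunLike.congr_fun hfg w)
  obtain ⟨E', -, hE', hfree⟩ := hadm _ G'
    (lt_of_le_of_lt (by exact_mod_cast copyCount_le_labelledCopyCount.trans hcount) hlt) (by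
      obtain ⟨v, hv⟩ := G'.exists_minimal_degree_vertex
      have hv' := hdeg (φ v)
      rw [φ.degree_eq, ← hv] at hv'
      convert hv')
  refine ⟨E'.image (Sym2.map e.symm), le_trans (by exact_mod_cast card_image_le) hE', ?_⟩
  rintro ⟨f⟩
  refine hfree ⟨⟨⟨fun w => e (f w), fun {a b} hab => ?_⟩, e.injective.comp f.injective⟩⟩
  have h := f.toHom.map_adj hab
  rw [deleteEdges_adj] at h ⊢
  refine ⟨by simpa [G'] using h.1, fun hmem => h.2 ?_⟩
  exact mem_coe.2 (mem_image.2 ⟨_, mem_coe.1 hmem, by simp⟩)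

/-- The complete `(p + 1)`-partite graph with parts `Fin N × Q`, with a clique added on each set
`{0} × {i} × Q` in the first part. -/
def clusteredTuran (p N : ℕ) (Q : Type*) : SimpleGraph (Fin (p + 1) × Fin N × Q) where
  Adj x y := x.1 ≠ y.1 ∨ (x.1 = 0 ∧ x.2.1 = y.2.1 ∧ x ≠ y)
  symm := ⟨by
    rintro x y (h | ⟨h1, h2, h3⟩)
    · exact Or.inl h.symm
    · by_cases h : x.1 = y.1
      · exact Or.inr ⟨h ▸ h1, h2.symm, h3.symm⟩
      · exact Or.inl (Ne.symm h)⟩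
  loopless := ⟨by simp⟩

open Classical in
theorem le_degree_clusteredTuran (p N : ℕ) (Q : Type*) [Fintype Q]
    (x : Fin (p + 1) × Fin N × Q) :
    p * (N * Fintype.card Q) ≤ (clusteredTuran p N Q).degree x := by
  rw [← card_neighborFinset_eq_degree]
  have : #(({x.1}ᶜ : Finset (Fin (p + 1))) ×ˢ (univ : Finset (Fin N × Q))) =
      p * (N * Fintype.card Q) := by
    simp [card_compl]
  rw [← this]
  refine card_le_card fun y hy => ?_
  simp only [mem_product, mem_compl, mem_singleton, mem_univ, and_true] at hy
  rw [mem_neighborFinset]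
  exact Or.inl (Ne.symm hy)

/-- Fewer than `N` edges miss some layer `i`, that is, no deleted edge has both ends there, and each
layer contains the whole `K_(p+2)[s]`. -/
theorem isContained_clusteredTuran_deleteEdges (p N s : ℕ)
    (E : Finset (Sym2 (Fin (p + 1) × Fin N × Bool × Fin s))) (hE : #E < N) :
    completeEquipartiteGraph (p + 2) s ⊑
      (clusteredTuran p N (Bool × Fin s)).deleteEdges (E : Set (Sym2 _)) := by
  obtain ⟨i, hi⟩ : ∃ i : Fin N, ∀ z ∈ E, ¬ ∀ x ∈ z, x.2.1 = i := by
    by_contra! h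
    choose f hfE hf using h
    have hinj : Function.Injective f := by
      intro i i' hii
      obtain ⟨x, hx⟩ : ∃ x, x ∈ f i := by
        induction f i using Sym2.inductionOn with
        | hf a b => exact ⟨a, Sym2.mem_mk_left a b⟩
      rw [← hf i x hx, ← hf i' x (hii ▸ hx)]
    have := Finset.card_le_card_of_injOn (s := (univ : Finset (Fin N))) (t := E) f
      (fun i _ => hfE i) hinj.injOn
    rw [card_univ, Fintype.card_fin] at this
    omega
  -- Classes `0` and `1` share the planted clique, told apart by the `Bool`; class `k + 1` goes to
  -- part `k`.
  let g : Fin (p + 2) × Fin s → Fin (p + 1) × Fin N × Bool × Fin s :=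
    fun a => ((Fin.cases 0 id a.1 : Fin (p + 1)), i, decide (a.1 = 0), a.2)
  have hfst : ∀ k k' : Fin (p + 2), (Fin.cases 0 id k : Fin (p + 1)) = Fin.cases 0 id k' →
      k ≠ k' → (Fin.cases 0 id k : Fin (p + 1)) = 0 ∧ (k = 0 ↔ ¬ k' = 0) := by
    intro k k'
    refine Fin.cases ?_ (fun k => ?_) k <;> refine Fin.cases ?_ (fun k' => ?_) k' <;>
      simp only [Fin.cases_zero, Fin.cases_succ, id_eq, Fin.succ_inj, ne_eq, Fin.succ_ne_zero,
        (Fin.succ_ne_zero _).symm] <;> tauto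
  have hg : Function.Injective g := by
    rintro ⟨k, j⟩ ⟨k', j'⟩ h
    simp only [g, Prod.mk.injEq, true_and, decide_eq_decide] at h
    obtain ⟨h1, h2, rfl⟩ := h
    by_contra hne
    have := (hfst k k' h1 fun hk => hne (by rw [hk])).2
    tauto
  refine ⟨⟨⟨g, fun {a b} hab => ?_⟩, hg⟩⟩
  rw [deleteEdges_adj]
  refine ⟨?_, fun hmem => hi _ hmem fun x hx => ?_⟩
  · by_cases h : (g a).1 = (g b).1
    · refine Or.inr ⟨(hfst a.1 b.1 h hab).1, rfl, fun hgab => hab ?_⟩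
      rw [hg hgab]
    · exact Or.inl h
  · rcases Sym2.mem_iff.1 hx with rfl | rfl <;> rfl

/-- Classes with a vertex outside part `0` need distinct parts, so at most `p` exist. Two classes
thus lie inside part `0`, and adjacency between them forces one common cluster. -/
theorem exists_three_vertices_same_cluster {p N s : ℕ} {Q : Type*} (hs : 2 ≤ s)
    (y : Fin (p + 2) × Fin s → Fin (p + 1) × Fin N × Q)
    (hy : ∀ a b, (completeEquipartiteGraph (p + 2) s).Adj a b →
      (clusteredTuran p N Q).Adj (y a) (y b)) :
    ∃ u v w, (u ≠ v ∧ u ≠ w ∧ v ≠ w) ∧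
      ((y v).1 = (y u).1 ∧ (y w).1 = (y u).1) ∧
      ((y v).2.1 = (y u).2.1 ∧ (y w).2.1 = (y u).2.1) := by
  classical
  let full : Finset (Fin (p + 2)) := {a | ∀ j, (y (a, j)).1 = 0}
  have hfull : #fullᶜ ≤ p := by
    have hex : ∀ a ∈ fullᶜ, ∃ j, (y (a, j)).1 ≠ 0 := by
      intro a ha
      simpa [full] using ha
    have : Nonempty (Fin s) := ⟨⟨0, by omega⟩⟩
    choose! j hj using hex
    have hle := card_le_card_of_injOn (s := fullᶜ) (t := {(0 : Fin (p + 1))}ᶜ)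
      (fun a => (y (a, j a)).1) (fun a ha => by simpa using hj a ha) (by
        intro a ha b _ hab
        by_contra hne
        rcases hy (a, j a) (b, j b) hne with h | h
        · exact h hab
        · exact hj a ha h.1)
    simpa [card_compl] using hle
  have hone : 1 < #full := by
    have := card_add_card_compl full
    rw [Fintype.card_fin] at this
    omega
  obtain ⟨a, ha, b, hb, hab⟩ := one_lt_card.1 hone
  simp only [full, mem_filter, mem_univ, true_and] at ha hb
  have hcl : ∀ j j', (y (a, j)).2.1 = (y (b, j')).2.1 := by
    intro j j'
    rcases hy (a, j) (b, j') hab with h | h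
    · exact absurd ((ha j).trans (hb j').symm) h
    · exact h.2.1
  refine ⟨(a, ⟨0, by omega⟩), (b, ⟨0, by omega⟩), (a, ⟨1, by omega⟩), ⟨?_, ?_, ?_⟩,
    ⟨?_, ?_⟩, (hcl _ _).symm, (hcl _ ⟨0, by omega⟩).trans (hcl _ _).symm⟩
  · simp [hab]
  · simp
  · simp [hab.symm]
  · rw [ha, hb]
  · rw [ha, ha]

/-- Once one of the three clustered vertices is placed, the other two have only `|Q|` choices each.
-/
theorem labelledCopyCount_clusteredTuran_le (p N s : ℕ) (hs : 2 ≤ s) (Q : Type*) [Fintype Q] :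
    (clusteredTuran p N Q).labelledCopyCount (completeEquipartiteGraph (p + 2) s) ≤
      ((p + 2) * s) ^ 3 * (Fintype.card Q ^ 2 *
        ((p + 1) * (N * Fintype.card Q)) ^ ((p + 2) * s - 2)) := by
  classical
  rw [labelledCopyCount_eq_card_filter]
  let W := Fin (p + 2) × Fin s
  let P : W × W × W → (W → Fin (p + 1) × Fin N × Q) → Prop := fun t y =>
    (t.1 ≠ t.2.1 ∧ t.1 ≠ t.2.2 ∧ t.2.1 ≠ t.2.2) ∧
      ((y t.2.1).1 = (y t.1).1 ∧ (y t.2.2).1 = (y t.1).1) ∧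
      ((y t.2.1).2.1 = (y t.1).2.1 ∧ (y t.2.2).2.1 = (y t.1).2.1)
  refine (card_le_card (t := (univ : Finset (W × W × W)).biUnion fun t => {y | P t y}) ?_).trans
    ((card_biUnion_le_card_mul _ _ (Fintype.card Q ^ 2 *
        ((p + 1) * (N * Fintype.card Q)) ^ ((p + 2) * s - 2)) ?_).trans (le_of_eq ?_))
  · intro y hy
    simp only [mem_filter, mem_univ, true_and] at hy
    obtain ⟨u, v, w, h⟩ := exists_three_vertices_same_cluster hs y hy.2
    simp only [mem_biUnion, mem_univ, true_and, mem_filter]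
    exact ⟨(u, v, w), h⟩
  · rintro ⟨u, v, w⟩ -
    by_cases hne : u ≠ v ∧ u ≠ w ∧ v ≠ w
    swap
    · rw [filter_eq_empty_iff.2 fun y _ hy => hne hy.1]
      simp
    refine (card_filter_fun_le (P (u, v, w)) {v, w}
      (fun y => ((y v).2.2, (y w).2.2)) ?_).trans (le_of_eq ?_)
    · rintro y y' ⟨-, ⟨h1, h2⟩, h3, h4⟩ ⟨-, ⟨h1', h2'⟩, h3', h4'⟩ hag hd
      simp only [Prod.mk.injEq] at hd h1 h2 h3 h4 h1' h2' h3' h4'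
      have hu : y u = y' u := hag u (by simp [hne.1, hne.2.1])
      funext z
      by_cases hzv : z = v
      · subst hzv
        exact Prod.ext (by rw [h1, h1', hu]) (Prod.ext (by rw [h3, h3', hu]) hd.1)
      by_cases hzw : z = w
      · subst hzw
        exact Prod.ext (by rw [h2, h2', hu]) (Prod.ext (by rw [h4, h4', hu]) hd.2)
      exact hag z (by simp [hzv, hzw])
    · rw [card_pair hne.2.2]
      simp [W, sq]
  · simp only [W, card_univ, Fintype.card_prod, Fintype.card_fin]
    ring

theorem not_forall_le_removalDelta (r s : ℕ) (hr : 2 ≤ r) (hs : 2 ≤ s) {γ μ : ℝ}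
    (hγ : γ ≤ ((r : ℝ) - 2) / ((r : ℝ) - 1)) (hμ : 0 < μ) :
    ∃ ε ∈ Set.Ioo (0 : ℝ) 1, removalDelta (completeEquipartiteGraph r s) γ ε < μ * ε := by
  obtain ⟨p, rfl⟩ : ∃ p, r = p + 2 := ⟨r - 2, by omega⟩
  by_contra! hcon
  set h := (p + 2) * s with hh
  have hh2 : 2 ≤ h := by nlinarith
  set K : ℝ := (p + 1) * (2 * s) with hK
  have hs' : (2 : ℝ) ≤ s := by exact_mod_cast hs
  have hKpos : 4 ≤ K := by
    have : (0 : ℝ) ≤ p := by positivity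
    nlinarith
  set C : ℝ := (h : ℝ) ^ 3 * (2 * s) ^ 2 with hC
  -- There are at most `C n^(h-2)` copies, to be compared with `μ ε n^h = (μ N / 2) n^(h-2)`.
  obtain ⟨N, hN⟩ := exists_nat_gt (2 * C / μ)
  have hNpos : (0 : ℝ) < N := lt_of_le_of_lt (by positivity) hN
  have hN1 : (1 : ℝ) ≤ N := by exact_mod_cast (by exact_mod_cast hNpos : 0 < N)
  set n : ℝ := K * N with hn
  have hnpos : 0 < n := by positivity
  have hcard : (Fintype.card (Fin (p + 1) × Fin N × Bool × Fin s) : ℝ) = n := by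
    simp only [Fintype.card_prod, Fintype.card_fin, Fintype.card_bool, hn, hK]
    push_cast
    ring
  -- Chosen so that `ε n^2 = N / 2 < N`.
  set ε : ℝ := 1 / (2 * K * n) with hε
  have hε01 : ε ∈ Set.Ioo (0 : ℝ) 1 := by
    refine ⟨by positivity, ?_⟩
    rw [hε, div_lt_one (by positivity)]
    nlinarith
  have hadm := (isGreatest_removalDelta (completeEquipartiteGraph (p + 2) s) γ ε).1.2
  have : Nonempty (Fin (p + 1) × Fin N × Bool × Fin s) :=
    ⟨0, ⟨0, by exact_mod_cast hNpos⟩, true, ⟨0, by omega⟩⟩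
  obtain ⟨E, hE, hfree⟩ := hadm.exists_free_deleteEdges (clusteredTuran p N (Bool × Fin s)) (by
    refine lt_of_lt_of_le ?_ (mul_le_mul_of_nonneg_right (hcon ε hε01) (by positivity))
    have hle := labelledCopyCount_clusteredTuran_le p N s hs (Bool × Fin s)
    simp only [Fintype.card_prod, Fintype.card_bool, Fintype.card_fin] at hle
    have hle' : ((clusteredTuran p N (Bool × Fin s)).labelledCopyCount
        (completeEquipartiteGraph (p + 2) s) : ℝ) ≤ C * n ^ (h - 2) := by
      refine (Nat.cast_le.2 hle).trans (le_of_eq ?_)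
      have : ((p : ℝ) + 1) * (N * (2 * s)) = n := by rw [hn, hK]; ring
      push_cast
      rw [this, hC, hh]
      push_cast
      ring
    refine lt_of_le_of_lt hle' ?_
    rw [hcard]
    simp only [Fintype.card_prod, Fintype.card_fin]
    rw [← hh]
    obtain ⟨k, hk⟩ : ∃ k, h = k + 2 := ⟨h - 2, by omega⟩
    rw [hk, Nat.add_sub_cancel, pow_add, hε]
    have : μ * (1 / (2 * K * n)) * (n ^ k * n ^ 2) = (μ * N / 2) * n ^ k := by
      field_simp
      rw [hn]
    rw [this]
    rw [div_lt_iff₀ hμ] at hN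
    gcongr
    linarith) (by
    intro v
    rw [hcard]
    have hdeg := le_degree_clusteredTuran p N (Bool × Fin s) v
    simp only [Fintype.card_prod, Fintype.card_bool, Fintype.card_fin] at hdeg
    refine le_trans ?_ (Nat.cast_le.2 hdeg)
    refine (mul_le_mul_of_nonneg_right hγ hnpos.le).trans (le_of_eq ?_)
    push_cast
    rw [hn, hK]
    have : ((p : ℝ) + 2 - 1) ≠ 0 := by
      have : (0 : ℝ) ≤ p := by positivity
      linarith
    field_simp
    ring)
  refine hfree (isContained_clusteredTuran_deleteEdges p N s E ?_)
  rw [hcard, hε] at hE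
  have : 1 / (2 * K * n) * n ^ 2 = N / 2 := by
    field_simp
    rw [hn]
  have : (#E : ℝ) < N := by linarith
  exact_mod_cast this

end LowerBound

/-! ### Linear removal above the threshold -/

section UpperBound

open Classical in
theorem canMakeFree_copyCount {V W : Type*} [Fintype V] (G : SimpleGraph V) {H : SimpleGraph W}
    (hH : H ≠ ⊥) {m : ℝ} (hm : (G.copyCount H : ℝ) ≤ m) : CanMakeFree H G m := by
  have hsub : (G.killCopies H).edgeFinset ⊆ G.edgeFinset :=
    edgeFinset_subset_edgeFinset.2 killCopies_le_left
  refine ⟨G.edgeFinset \ (G.killCopies H).edgeFinset, ?_, le_trans ?_ hm, ?_⟩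
  · intro e he
    simpa using (mem_sdiff.1 (mem_coe.1 he)).1
  · have := le_card_edgeFinset_killCopies_add_copyCount (G := G) (H := H)
    rw [card_sdiff_of_subset hsub]
    exact_mod_cast Nat.sub_le_iff_le_add'.2 this
  · have : G.deleteEdges ((G.edgeFinset \ (G.killCopies H).edgeFinset : Finset (Sym2 V)) :
        Set (Sym2 V)) = G.killCopies H := by
      ext a b
      simp only [deleteEdges_adj, coe_sdiff, coe_edgeFinset, Set.mem_sdiff, mem_edgeSet, not_and,
        not_not]
      exact ⟨fun h => h.2 h.1, fun h => ⟨killCopies_le_left h, fun _ => h⟩⟩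
    rw [this]
    exact free_killCopies hH

theorem exists_forall_le_removalDelta (r s : ℕ) (hr : 2 ≤ r) (hs : 1 ≤ s) {γ : ℝ} (hγ : γ ≤ 1)
    (hγ' : ((r : ℝ) - 2) / ((r : ℝ) - 1) < γ) :
    ∃ μ : ℝ, 0 < μ ∧ ∀ ε ∈ Set.Ioo (0 : ℝ) 1,
      μ * ε ≤ removalDelta (completeEquipartiteGraph r s) γ ε := by
  obtain ⟨β, hβ, n₀, hn₀⟩ := exists_mul_pow_le_copyCount r s hr hs hγ hγ'
  have hH : completeEquipartiteGraph r s ≠ ⊥ := by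
    rw [Ne, completeEquipartiteGraph_eq_bot_iff]
    omega
  -- The bound by `β` makes the hypothesis impossible for `n ≥ n₀`; the other gives `μ n^(r s) ≤ 1`
  -- for `n < n₀`, where deleting one edge per copy costs at most `ε ≤ ε n^2` if `n > 0`.
  set μ : ℝ := min β (1 / ((n₀ : ℝ) + 1) ^ (r * s)) with hμ
  have hμpos : 0 < μ := lt_min hβ (by positivity)
  have hμ1 : μ ≤ 1 := (min_le_right _ _).trans (by
    rw [div_le_one (by positivity)]
    exact one_le_pow₀ (by linarith [(Nat.cast_nonneg n₀ : (0 : ℝ) ≤ n₀)]))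
  refine ⟨μ, hμpos, fun ε hε => (isGreatest_removalDelta _ γ ε).2 ⟨⟨?_, ?_⟩, ?_⟩⟩
  · exact mul_nonneg hμpos.le hε.1.le
  · exact mul_le_one₀ hμ1 hε.1.le hε.2.le
  · intro n G hlt hdeg
    simp only [Fintype.card_prod, Fintype.card_fin] at hlt
    rcases le_or_gt n₀ n with hn | hn
    · refine absurd (hn₀ n hn G hdeg) (not_le.2 (hlt.trans_le ?_))
      gcongr
      exact (mul_le_of_le_one_right hμpos.le hε.2.le).trans (min_le_left _ _)
    · refine canMakeFree_copyCount G hH (hlt.le.trans ?_)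
      rcases Nat.eq_zero_or_pos n with rfl | hnpos
      · have : r * s ≠ 0 := by positivity
        simp [this]
      have h1 : μ * (n : ℝ) ^ (r * s) ≤ 1 := by
        calc μ * (n : ℝ) ^ (r * s) ≤ 1 / ((n₀ : ℝ) + 1) ^ (r * s) * ((n₀ : ℝ) + 1) ^ (r * s) := by
              gcongr
              · exact min_le_right _ _
              · have : (n : ℝ) < n₀ := by exact_mod_cast hn
                linarith
          _ = 1 := by field_simp
      have h2 : (1 : ℝ) ≤ (n : ℝ) ^ 2 := one_le_pow₀ (by exact_mod_cast hnpos)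
      nlinarith [hε.1]

end UpperBound

end MinDegreeRemoval

theorem proposition4p2 (r s : ℕ) (hr : 3 ≤ r) (hs : 2 ≤ s) :
    MinDegreeRemoval.linearRemovalThreshold (SimpleGraph.completeEquipartiteGraph r s) =
      ((r : ℝ) - 2) / ((r : ℝ) - 1) := by
  have hr' : (3 : ℝ) ≤ r := by exact_mod_cast hr
  have h0 : (0 : ℝ) ≤ ((r : ℝ) - 2) / ((r : ℝ) - 1) :=
    div_nonneg (by linarith) (by linarith)
  have h1 : ((r : ℝ) - 2) / ((r : ℝ) - 1) < 1 := by
    rw [div_lt_one (by linarith)]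
    linarith
  unfold MinDegreeRemoval.linearRemovalThreshold
  refine (congrArg sInf (Set.ext fun γ => ?_)).trans (csInf_Ioc h1)
  constructor
  · rintro ⟨hγ, μ, hμ, h⟩
    refine ⟨not_le.1 fun hle => ?_, hγ.2⟩
    obtain ⟨ε, hε, hlt⟩ := MinDegreeRemoval.not_forall_le_removalDelta r s (by omega) hs hle hμ
    exact absurd (h ε hε) (not_le.2 hlt)
  · rintro ⟨hγ, hγ1⟩
    exact ⟨⟨h0.trans hγ.le, hγ1⟩,
      MinDegreeRemoval.exists_forall_le_removalDelta r s (by omega) (by omega) hγ1 hγ⟩
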